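/- Let $k\ge 4$. Let $G_k$ be the hexagonal grid graph obtained from one hexagon by surrounding it successively with $k-1$ crowns of hexagons; it has $6k^2$ vertices. Label a vertex by the triple $(l,h,r)$ of the numbers of the three lines through it (zigzag paths parallel to the sides of $G_k$), where h-lines are horizontal and numbered upwards, l-lines are numbered to the right, r-lines are numbered to the left, and number $0$ is given to the lines through the lowest vertex of the central hexagon. Explicitly, the vertices of $G_k$ are the triples of integers $(l,h,r)$ with $-k+1\le l,h,r\le k$ and $l+r-h\in\{0,1\}$, and two of them are adjacent if and only if they agree in two coordinates and differ by $1$ in the third. Let $$A_k=\{(2,-k+2,-k+1)\}\cup\{(3+i,-k+4+2i,-k+1+i) : 0\le i\le k-3\},$$ $$B_k=\{(k,k,1),\,(k-1,k-1,0),\,(k-2,k-3,-1)\}\cup\{(i,-k+1+2i,-k+2+i) : 0\le i\le k-3\},$$ let $\bar A_k,\bar B_k$ be the images of $A_k,B_k$ under the rotation by $180^\circ$ about the centre of the grid, that is, $(l,h,r)\mapsto(1-l,1-h,1-r)$, and let $X_k=A_k\cup B_k\cup\bar A_k\cup\bar B_k$. For a connected graph $G$ and $X\subseteq V(G)$, two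 vertices $x,y$ are $X$-visible if there is a shortest $x,y$-path with no internal vertex in $X$; $X$ is a mutual-visibility set if its vertices are pairwise $X$-visible; a $\mu$-set is a mutual-visibility set of largest cardinality, and $\mu(G)$ is that cardinality. Then $X_k$ is a set of $4k$ vertices of $G_k$ and is a $\mu$-set of $G_k$; in particular $\mu(G_k)=4k$. -/

import Mathlib

/-! ### Mutual visibility in graphs -/

/-- `x` and `y` are `X`-visible in `G`: some shortest `x,y`-path has no internal vertex in `X`. -/
def IsShortestPathVisible {V : Type*} (G : SimpleGraph V) (X : Set V) (x y : V) : Prop :=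
  ∃ p : G.Walk x y, p.IsPath ∧ p.length = G.dist x y ∧
    ∀ z ∈ p.support, z ≠ x → z ≠ y → z ∉ X

/-- `X` is a mutual-visibility set of `G`: its vertices are pairwise `X`-visible. -/
def IsMutualVisibilitySet {V : Type*} (G : SimpleGraph V) (X : Set V) : Prop :=
  ∀ x ∈ X, ∀ y ∈ X, x ≠ y → IsShortestPathVisible G X x y

/-- `X` is a `μ`-set of `G`: a mutual-visibility set of largest cardinality. -/
def IsMuSet {V : Type*} (G : SimpleGraph V) (X : Set V) : Prop :=
  IsMutualVisibilitySet G X ∧ ∀ Y : Set V, IsMutualVisibilitySet G Y → Y.encard ≤ X.encard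

/-- The mutual-visibility number `μ(G)`: the largest cardinality of a mutual-visibility set. -/
noncomputable def mutualVisibilityNumber {V : Type*} (G : SimpleGraph V) : ℕ∞ :=
  ⨆ X : {X : Set V // IsMutualVisibilitySet G X}, X.1.encard

/-! ### The hexagonal grid `G_k`

A vertex is labelled by the triple `(l, h, r)` of the numbers of the l-line, the h-line and the
r-line through it. Each line is a zigzag path parallel to one of the three directions of sides of
`G_k`, and the three lines through the lowest vertex of the central hexagon have number `0`. The
h-lines are numbered upwards, the l-lines to the right, the r-lines to the left, and the central
hexagon lies on the lines `0` and `1` of each family. The labels of the vertices of the infinite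
hexagonal lattice are exactly the integer triples with `l + r - h ∈ {0, 1}`. An edge lies on two
lines of different families and crosses from one line of the third family to the next, so two
vertices are adjacent exactly if their labels agree in two places and differ by `1` in the third.
The grid `G_k` (`k - 1` crowns of hexagons around the central one) is cut out by the `2k` lines
of each family with numbers `-k + 1, …, k`. -/

/-- The labels `(l, h, r)` of the vertices of `G_k`. -/
def hexVertices (k : ℕ) : Set (ℤ × ℤ × ℤ) :=
  {p | (p.1 + p.2.2 - p.2.1 = 0 ∨ p.1 + p.2.2 - p.2.1 = 1) ∧
    (-(k : ℤ) + 1 ≤ p.1 ∧ p.1 ≤ k) ∧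
    (-(k : ℤ) + 1 ≤ p.2.1 ∧ p.2.1 ≤ k) ∧
    (-(k : ℤ) + 1 ≤ p.2.2 ∧ p.2.2 ≤ k)}

/-- Integer triples, adjacent if they differ by `1` in exactly one coordinate. -/
def unitStepGraph : SimpleGraph (ℤ × ℤ × ℤ) where
  Adj p q := |p.1 - q.1| + |p.2.1 - q.2.1| + |p.2.2 - q.2.2| = 1
  symm := ⟨fun p q h => by
    rw [abs_sub_comm q.1, abs_sub_comm q.2.1, abs_sub_comm q.2.2]; exact h⟩
  loopless := ⟨fun p h => by simp at h⟩

/-- The hexagonal grid graph `G_k`. -/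
def hexGrid (k : ℕ) : SimpleGraph (hexVertices k) :=
  unitStepGraph.induce (hexVertices k)

/-! ### The set `X_k` -/

/-- The rotation by 180 degrees around the centre of the central hexagon. -/
def rot180 (p : ℤ × ℤ × ℤ) : ℤ × ℤ × ℤ :=
  (1 - p.1, 1 - p.2.1, 1 - p.2.2)

/-- `A_k`, consisting of `a` and of `a_i` for `i = 0, …, k - 3`. -/
def setA (k : ℕ) : Finset (ℤ × ℤ × ℤ) :=
  {(2, -(k : ℤ) + 2, -(k : ℤ) + 1)} ∪
    (Finset.range (k - 2)).image fun i : ℕ =>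
      (3 + (i : ℤ), -(k : ℤ) + 4 + 2 * (i : ℤ), -(k : ℤ) + 1 + (i : ℤ))

/-- `B_k`, consisting of `b`, `b'`, `b''` and of `b_i` for `i = 0, …, k - 3`. -/
def setB (k : ℕ) : Finset (ℤ × ℤ × ℤ) :=
  {((k : ℤ), (k : ℤ), 1), ((k : ℤ) - 1, (k : ℤ) - 1, 0), ((k : ℤ) - 2, (k : ℤ) - 3, -1)} ∪
    (Finset.range (k - 2)).image fun i : ℕ =>
      ((i : ℤ), -(k : ℤ) + 1 + 2 * (i : ℤ), -(k : ℤ) + 2 + (i : ℤ))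

/-- `X_k`, the union of `A_k`, `B_k` and their images under the rotation by 180 degrees. -/
def setX (k : ℕ) : Finset (ℤ × ℤ × ℤ) :=
  setA k ∪ setB k ∪ (setA k).image rot180 ∪ (setB k).image rot180

/-! Graph distance in `G_k` is the taxicab distance of labels: an edge changes one label by 1, and
from every vertex of the box spanned by two vertices some edge of the box leads closer to the target
(`Reaches.box`). So a shortest path can be prescribed by waypoints running monotonically through the
box.

Upper bound: along an h-line the distance is the difference of `l - r`, and equality in the triangle
inequality forces every shortest path between two vertices of the line to follow it
(`mem_support_of_h_eq`). Hence a mutual-visibility set has at most two vertices on each of the `2k`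
h-lines.

Lower bound: `A_k ∪ B_k` has exactly one vertex on each h-line, and the rotated copy supplies the
second. In terms of `d = l - r`, the `a_i` form the column `d = k + 2`, the `b_i` the column `d = k
- 2`, while `a` has `d = k + 1` and `b`, `b'`, `b''` have `d = k - 1`. The rotation negates `d`, so
the middle region `|d| < k - 2` is free of `X_k`. Vertices of `A_k ∪ B_k` mostly see each other
along the columns, through the corridor `k - 1 ≤ d ≤ k + 1` or around its sides; a vertex and a
rotated one see each other across the middle, after slipping through the gaps of the columns. Each
family of pairs gets waypoints whose boxes or strips avoid `X_k`, which is linear integer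
arithmetic; `sees_of_inX` collects the families. -/

/-! ### Points in `(l, r, s)` coordinates -/

/-- The vertex of the hexagonal lattice with line numbers `l` and `r` and offset
`s = l + r - h`. -/
def hexPoint (l r s : ℤ) : ℤ × ℤ × ℤ := (l, l + r - s, r)

/-- `hexPoint l r s` is a vertex of the grid. -/
abbrev InGrid (k : ℕ) (l r s : ℤ) : Prop :=
  (s = 0 ∨ s = 1) ∧ (-(k : ℤ) + 1 ≤ l ∧ l ≤ k) ∧ (-(k : ℤ) + 1 ≤ l + r - s ∧ l + r - s ≤ k) ∧
    (-(k : ℤ) + 1 ≤ r ∧ r ≤ k)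

theorem hexPoint_mem {k : ℕ} {l r s : ℤ} : hexPoint l r s ∈ hexVertices k ↔ InGrid k l r s := by
  simp only [hexVertices, hexPoint, Set.mem_ofPred_eq, InGrid]
  omega

theorem exists_hexPoint {k : ℕ} {p : ℤ × ℤ × ℤ} (hp : p ∈ hexVertices k) :
    ∃ l r s, p = hexPoint l r s ∧ InGrid k l r s := by
  obtain ⟨l, h, r⟩ := p
  have e : (l, h, r) = hexPoint l r (l + r - h) := by simp [hexPoint]
  exact ⟨l, r, l + r - h, e, hexPoint_mem.1 (e ▸ hp)⟩

theorem hexPoint_inj {l r s l' r' s' : ℤ} :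
    hexPoint l r s = hexPoint l' r' s' ↔ l = l' ∧ r = r' ∧ s = s' := by
  simp only [hexPoint, Prod.mk.injEq]
  omega

/-- The taxicab distance of integer triples. -/
def taxicab (p q : ℤ × ℤ × ℤ) : ℤ := |p.1 - q.1| + |p.2.1 - q.2.1| + |p.2.2 - q.2.2|

theorem taxicab_comm (p q : ℤ × ℤ × ℤ) : taxicab p q = taxicab q p := by
  simp only [taxicab, abs_sub_comm]

theorem taxicab_self (p : ℤ × ℤ × ℤ) : taxicab p p = 0 := by simp [taxicab]

theorem taxicab_triangle (p q t : ℤ × ℤ × ℤ) : taxicab p t ≤ taxicab p q + taxicab q t := by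
  have h1 := abs_sub_le p.1 q.1 t.1
  have h2 := abs_sub_le p.2.1 q.2.1 t.2.1
  have h3 := abs_sub_le p.2.2 q.2.2 t.2.2
  simp only [taxicab]
  omega

theorem hexGrid_adj {k : ℕ} {u v : hexVertices k} :
    (hexGrid k).Adj u v ↔ taxicab u v = 1 := Iff.rfl

theorem taxicab_le_length {k : ℕ} {u v : hexVertices k} (p : (hexGrid k).Walk u v) :
    taxicab u v ≤ p.length := by
  induction p with
  | nil => simp [taxicab_self]
  | @cons u v w h p ih =>
    have h1 := hexGrid_adj.1 h
    have h2 := taxicab_triangle u v w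
    simp only [SimpleGraph.Walk.length_cons]
    push_cast
    omega

/-! ### Shortest walks inside a prescribed set -/

/-- There is a walk from `u` to `v` in the grid, of length the taxicab distance, all of whose
vertices satisfy `P`. -/
def Reaches (k : ℕ) (P : ℤ × ℤ × ℤ → Prop) (u v : ℤ × ℤ × ℤ) : Prop :=
  ∃ (hu : u ∈ hexVertices k) (hv : v ∈ hexVertices k) (p : (hexGrid k).Walk ⟨u, hu⟩ ⟨v, hv⟩),
    (p.length : ℤ) = taxicab u v ∧ ∀ z ∈ p.support, P z

namespace Reaches

variable {k : ℕ} {P : ℤ × ℤ × ℤ → Prop}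

/-- The walk supplied by `Reaches` attains the lower bound of `taxicab_le_length`. -/
theorem dist_eq {u v : hexVertices k} (h : Reaches k P u v) :
    ((hexGrid k).dist u v : ℤ) = taxicab u v := by
  obtain ⟨hu, hv, p, hp, -⟩ := h
  have h1 := SimpleGraph.dist_le p
  obtain ⟨q, hq⟩ := SimpleGraph.Reachable.exists_walk_length_eq_dist ⟨p⟩
  have h2 := taxicab_le_length q
  simp only [Subtype.coe_eta] at h1 hq
  simp only at h2
  omega

theorem symm {u v : ℤ × ℤ × ℤ} (h : Reaches k P u v) : Reaches k P v u := by
  obtain ⟨hu, hv, p, hp, hP⟩ := h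
  refine ⟨hv, hu, p.reverse, ?_, ?_⟩
  · rw [SimpleGraph.Walk.length_reverse, hp, taxicab_comm]
  · intro z hz
    exact hP z (by simpa using hz)

theorem mono {Q : ℤ × ℤ × ℤ → Prop} (hPQ : ∀ z, P z → Q z) {u v : ℤ × ℤ × ℤ}
    (h : Reaches k P u v) : Reaches k Q u v := by
  obtain ⟨hu, hv, p, hp, hP⟩ := h
  exact ⟨hu, hv, p, hp, fun z hz => hPQ z (hP z hz)⟩

theorem trans_of_taxicab {u v w : ℤ × ℤ × ℤ} (h₁ : Reaches k P u v) (h₂ : Reaches k P v w)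
    (h : taxicab u v + taxicab v w = taxicab u w) : Reaches k P u w := by
  obtain ⟨hu, hv, p, hp, hP⟩ := h₁
  obtain ⟨_, hw, q, hq, hQ⟩ := h₂
  refine ⟨hu, hw, p.append q, ?_, ?_⟩
  · rw [SimpleGraph.Walk.length_append]
    push_cast
    omega
  · intro z hz
    rcases SimpleGraph.Walk.mem_support_append_iff _ _ |>.1 hz with hz | hz
    exacts [hP z hz, hQ z hz]

/-- If from each point of a region other than `v` one can step inside the region towards `v`,
then `v` is reached from all points of the region. -/
theorem of_step {v : ℤ × ℤ × ℤ} (Q : ℤ × ℤ × ℤ → Prop) (hv : Q v)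
    (hQ : ∀ w, Q w → w ∈ hexVertices k ∧ P w)
    (step : ∀ w, Q w → w ≠ v → ∃ w', Q w' ∧ taxicab w w' = 1 ∧ taxicab w' v + 1 = taxicab w v)
    {u : ℤ × ℤ × ℤ} (hu : Q u) : Reaches k P u v := by
  obtain ⟨n, hn⟩ : ∃ n : ℕ, taxicab u v = n :=
    ⟨(taxicab u v).toNat, (Int.toNat_of_nonneg (by simp only [taxicab]; positivity)).symm⟩
  induction n generalizing u with
  | zero =>
    have e : u = v := by
      by_contra hne
      obtain ⟨w, -, -, h⟩ := step u hu hne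
      have : 0 ≤ taxicab w v := by simp only [taxicab]; positivity
      omega
    subst e
    exact ⟨(hQ _ hv).1, (hQ _ hv).1, .nil, by simp [taxicab_self], by simpa using (hQ _ hv).2⟩
  | succ n ih =>
    have hne : u ≠ v := by
      rintro rfl
      rw [taxicab_self] at hn
      omega
    obtain ⟨w, hw, h1, h2⟩ := step u hu hne
    obtain ⟨hw', hv', p, hp, hP⟩ := ih hw (by push_cast at hn; omega)
    have hadj : (hexGrid k).Adj ⟨u, (hQ _ hu).1⟩ ⟨w, hw'⟩ := hexGrid_adj.2 h1
    refine ⟨(hQ _ hu).1, hv', .cons hadj p, ?_, ?_⟩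
    · rw [SimpleGraph.Walk.length_cons]
      push_cast
      omega
    · intro z hz
      rcases List.mem_cons.1 (by simpa using hz) with rfl | hz
      exacts [(hQ _ hu).2, hP z hz]

end Reaches

/-- `b` lies between `a` and `c`. -/
abbrev Between (a b c : ℤ) : Prop := a ≤ b ∧ b ≤ c ∨ c ≤ b ∧ b ≤ a

theorem taxicab_add_of_between {l r s l' r' s' l'' r'' s'' : ℤ}
    (h : Between l l' l'' ∧ Between r r' r'' ∧ Between (l + r - s) (l' + r' - s') (l'' + r'' - s'')) :
    taxicab (hexPoint l r s) (hexPoint l' r' s') + taxicab (hexPoint l' r' s') (hexPoint l'' r'' s'')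
      = taxicab (hexPoint l r s) (hexPoint l'' r'' s'') := by
  simp only [taxicab, hexPoint, Int.abs_eq_natAbs, Between] at *
  omega

namespace Reaches

variable {k : ℕ} {P : ℤ × ℤ × ℤ → Prop} {l r s l' r' s' l'' r'' s'' : ℤ}

theorem trans (h₁ : Reaches k P (hexPoint l r s) (hexPoint l' r' s'))
    (h₂ : Reaches k P (hexPoint l' r' s') (hexPoint l'' r'' s''))
    (h : Between l l' l'' ∧ Between r r' r'' ∧ Between (l + r - s) (l' + r' - s') (l'' + r'' - s'')) :
    Reaches k P (hexPoint l r s) (hexPoint l'' r'' s'') :=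
  h₁.trans_of_taxicab h₂ (taxicab_add_of_between h)

/-- The three edges at a vertex of offset 0 raise `l`, raise `r` or lower `h`; at offset 1 they do
the opposite. Each alternative demands that the changed number is still on the wrong side of its
target. -/
theorem of_step_hexPoint (Q : ℤ → ℤ → ℤ → Prop) (hv : Q l' r' s')
    (hQ : ∀ l r s, Q l r s → InGrid k l r s ∧ P (hexPoint l r s))
    (step : ∀ l r s, Q l r s → ¬ (l = l' ∧ r = r' ∧ s = s') →
      (s = 0 ∧ ((Q (l + 1) r 1 ∧ l < l') ∨ (Q l (r + 1) 1 ∧ r < r') ∨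
        (Q l r 1 ∧ l' + r' - s' < l + r - s))) ∨
      (s = 1 ∧ ((Q (l - 1) r 0 ∧ l' < l) ∨ (Q l (r - 1) 0 ∧ r' < r) ∨
        (Q l r 0 ∧ l + r - s < l' + r' - s'))))
    (hu : Q l r s) : Reaches k P (hexPoint l r s) (hexPoint l' r' s') := by
  refine of_step (fun w => ∃ l r s, w = hexPoint l r s ∧ Q l r s) ⟨_, _, _, rfl, hv⟩ ?_ ?_
    ⟨_, _, _, rfl, hu⟩
  · rintro _ ⟨l, r, s, rfl, h⟩
    exact ⟨hexPoint_mem.2 (hQ _ _ _ h).1, (hQ _ _ _ h).2⟩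
  · rintro _ ⟨l, r, s, rfl, h⟩ hne
    rw [ne_eq, hexPoint_inj] at hne
    rcases step l r s h hne with ⟨rfl, ⟨h, h'⟩ | ⟨h, h'⟩ | ⟨h, h'⟩⟩ | ⟨rfl, ⟨h, h'⟩ | ⟨h, h'⟩ | ⟨h, h'⟩⟩
    all_goals
      refine ⟨_, ⟨_, _, _, rfl, h⟩, ?_, ?_⟩ <;> simp only [taxicab, hexPoint, Int.abs_eq_natAbs] <;> omega

/-- If all grid points in the box spanned by two grid points satisfy `P`, one is reached from the
other. -/
theorem box (hu : InGrid k l r s) (hv : InGrid k l' r' s')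
    (hP : ∀ a b c, InGrid k a b c → Between l a l' → Between r b r' →
      Between (l + r - s) (a + b - c) (l' + r' - s') → P (hexPoint a b c)) :
    Reaches k P (hexPoint l r s) (hexPoint l' r' s') := by
  refine of_step_hexPoint (fun a b c => (c = 0 ∨ c = 1) ∧ Between l a l' ∧ Between r b r' ∧
      Between (l + r - s) (a + b - c) (l' + r' - s')) (by omega) ?_ ?_ (by omega)
  · rintro a b c ⟨h0, h1, h2, h3⟩
    have : InGrid k a b c := by omega
    exact ⟨this, hP a b c this h1 h2 h3⟩
  · rintro a b c ⟨rfl | rfl, h⟩ hne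
    · refine Or.inl ⟨rfl, ?_⟩
      by_cases h1 : a < l'
      · left; omega
      by_cases h2 : b < r'
      · right; left; omega
      -- With `a ≥ l'`, `b ≥ r'` and offset 0, the h-number `a + b` exceeds the target's unless the
      -- target is reached.
      right; right; omega
    · refine Or.inr ⟨rfl, ?_⟩
      by_cases h1 : l' < a
      · left; omega
      by_cases h2 : r' < b
      · right; left; omega
      right; right; omega

/-- In a box spanned in the direction in which all three line numbers increase, one may restrict
to a strip `t ≤ l - r ≤ t'`. -/
theorem strip (t t' : ℤ) (hu : InGrid k l r s) (hv : InGrid k l' r' s')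
    (hlt : t < t' ∧ l ≤ l' ∧ r ≤ r' ∧ l + r - s ≤ l' + r' - s')
    (ht : t ≤ l - r ∧ l - r ≤ t' ∧ t ≤ l' - r' ∧ l' - r' ≤ t')
    (hP : ∀ a b c, InGrid k a b c → l ≤ a → a ≤ l' → r ≤ b → b ≤ r' → l + r - s ≤ a + b - c →
      a + b - c ≤ l' + r' - s' → t ≤ a - b → a - b ≤ t' → P (hexPoint a b c)) :
    Reaches k P (hexPoint l r s) (hexPoint l' r' s') := by
  refine of_step_hexPoint (fun a b c => (c = 0 ∨ c = 1) ∧ (l ≤ a ∧ a ≤ l') ∧ (r ≤ b ∧ b ≤ r') ∧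
      (l + r - s ≤ a + b - c ∧ a + b - c ≤ l' + r' - s') ∧ t ≤ a - b ∧ a - b ≤ t')
      (by omega) ?_ ?_ (by omega)
  · rintro a b c ⟨h0, h1, h2, h3, h4, h5⟩
    have : InGrid k a b c := by omega
    exact ⟨this, hP a b c this h1.1 h1.2 h2.1 h2.2 h3.1 h3.2 h4 h5⟩
  · rintro a b c ⟨rfl | rfl, h⟩ hne
    · refine Or.inl ⟨rfl, ?_⟩
      -- Raise `l` while the strip permits. Otherwise raising `r` lowers `l - r` by one, which stays
      -- at least `t` since `t < t'` and `t ≤ l' - r'`. At offset 1 raising `h` leaves `l - r`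
      -- unchanged.
      by_cases h1 : a < l' ∧ a - b < t'
      · left; omega
      · right; left; omega
    · exact Or.inr ⟨rfl, by right; right; omega⟩

end Reaches

/-! ### The upper bound -/

theorem hexGrid_reaches {k : ℕ} (u v : hexVertices k) : Reaches k (fun _ => True) u v := by
  obtain ⟨l, r, s, e, h⟩ := exists_hexPoint u.2
  obtain ⟨l', r', s', e', h'⟩ := exists_hexPoint v.2
  rw [e, e']
  exact .box h h' fun _ _ _ _ _ _ _ => trivial

theorem hexGrid_dist {k : ℕ} (u v : hexVertices k) :
    ((hexGrid k).dist u v : ℤ) = taxicab u v :=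
  (hexGrid_reaches u v).dist_eq

/-- On an h-line, a vertex between two others is determined by its distances from them. -/
theorem eq_of_taxicab_le {k : ℕ} {x y z w : ℤ × ℤ × ℤ} (hx : x ∈ hexVertices k)
    (hy : y ∈ hexVertices k) (hz : z ∈ hexVertices k) (hw : w ∈ hexVertices k)
    (hxy : x.2.1 = y.2.1) (hyz : y.2.1 = z.2.1) (h₁ : x.1 - x.2.2 < y.1 - y.2.2)
    (h₂ : y.1 - y.2.2 < z.1 - z.2.2) (hxw : taxicab x w ≤ taxicab x y)
    (hwz : taxicab w z ≤ taxicab y z) : w = y := by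
  obtain ⟨l, r, s, rfl, hx⟩ := exists_hexPoint hx
  obtain ⟨l', r', s', rfl, hy⟩ := exists_hexPoint hy
  obtain ⟨l'', r'', s'', rfl, hz⟩ := exists_hexPoint hz
  obtain ⟨a, b, c, rfl, hw⟩ := exists_hexPoint hw
  have hs := hx.1
  have hs' := hy.1
  have hs'' := hz.1
  have hc := hw.1
  clear hx hy hz hw
  simp only [hexPoint] at hxy hyz h₁ h₂
  rw [hexPoint_inj]
  simp only [taxicab, hexPoint] at hxw hwz
  rw [abs_of_nonpos (by omega : l - l' ≤ 0), abs_of_nonneg (by omega : 0 ≤ r - r'),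
    show l + r - s - (l' + r' - s') = 0 by omega, abs_zero] at hxw
  rw [abs_of_nonpos (by omega : l' - l'' ≤ 0), abs_of_nonneg (by omega : 0 ≤ r' - r''),
    show l' + r' - s' - (l'' + r'' - s'') = 0 by omega, abs_zero] at hwz
  -- Taxicab distance dominates the change of `l - r` plus the change of `h`. The two bounds on `w`
  -- leave no slack, so `w` stays on the h-line and has the same `l - r` as `y`.
  have i1 := neg_abs_le (l - a)
  have i2 := le_abs_self (r - b)
  have i3 := neg_abs_le (a - l'')
  have i4 := le_abs_self (b - r'')
  have i5 := le_abs_self (l + r - s - (a + b - c))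
  have i6 := neg_abs_le (l + r - s - (a + b - c))
  have i7 := abs_nonneg (a + b - c - (l'' + r'' - s''))
  have e₁ : |l + r - s - (a + b - c)| ≤ 0 := by linarith
  have e₂ : a - b = l' - r' := by linarith
  have e₃ := abs_nonpos_iff.1 e₁
  clear hxw hwz i1 i2 i3 i4 i5 i6 i7 e₁ h₁ h₂ hs hs'' hyz
  omega

theorem taxicab_add_of_h_eq {k : ℕ} {x y z : ℤ × ℤ × ℤ} (hx : x ∈ hexVertices k)
    (hy : y ∈ hexVertices k) (hz : z ∈ hexVertices k)
    (hxy : x.2.1 = y.2.1) (hyz : y.2.1 = z.2.1) (h₁ : x.1 - x.2.2 < y.1 - y.2.2)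
    (h₂ : y.1 - y.2.2 < z.1 - z.2.2) : taxicab x y + taxicab y z = taxicab x z := by
  obtain ⟨l, r, s, rfl, hx⟩ := exists_hexPoint hx
  obtain ⟨l', r', s', rfl, hy⟩ := exists_hexPoint hy
  obtain ⟨l'', r'', s'', rfl, hz⟩ := exists_hexPoint hz
  have hs := hx.1
  have hs' := hy.1
  have hs'' := hz.1
  clear hx hy hz
  simp only [hexPoint] at hxy hyz h₁ h₂
  exact taxicab_add_of_between (by omega)

/-- On an h-line, a vertex between two others lies on every shortest path joining them. -/
theorem mem_support_of_h_eq {k : ℕ} {x y z : hexVertices k} (hxy : x.1.2.1 = y.1.2.1)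
    (hyz : y.1.2.1 = z.1.2.1) (h₁ : x.1.1 - x.1.2.2 < y.1.1 - y.1.2.2)
    (h₂ : y.1.1 - y.1.2.2 < z.1.1 - z.1.2.2) (p : (hexGrid k).Walk x z)
    (hp : p.length = (hexGrid k).dist x z) : y ∈ p.support := by
  have hd := hexGrid_dist x z
  have h0 := hexGrid_dist x y
  have ht := taxicab_le_length (p.take ((hexGrid k).dist x y))
  have hr := taxicab_le_length (p.drop ((hexGrid k).dist x y))
  rw [p.take_length] at ht
  rw [p.drop_length] at hr
  have hle := taxicab_add_of_h_eq x.2 y.2 z.2 hxy hyz h₁ h₂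
  have hnn : 0 ≤ taxicab y z := by simp only [taxicab]; positivity
  -- Cutting `p` after `dist x y` steps gives a vertex at most as far from `x` and from `z` as `y`
  -- is.
  have e : p.getVert ((hexGrid k).dist x y) = y :=
    Subtype.ext (eq_of_taxicab_le x.2 y.2 z.2 (p.getVert _).2 hxy hyz h₁ h₂ (by omega) (by omega))
  exact e ▸ p.getVert_mem_support _

theorem not_visible_of_h_eq {k : ℕ} {Y : Set (hexVertices k)} {x y z : hexVertices k} (hy : y ∈ Y)
    (hxy : x.1.2.1 = y.1.2.1) (hyz : y.1.2.1 = z.1.2.1)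
    (h₁ : x.1.1 - x.1.2.2 < y.1.1 - y.1.2.2) (h₂ : y.1.1 - y.1.2.2 < z.1.1 - z.1.2.2) :
    ¬ IsShortestPathVisible (hexGrid k) Y x z := by
  rintro ⟨p, -, hp, hY⟩
  refine hY y (mem_support_of_h_eq hxy hyz h₁ h₂ p hp) ?_ ?_ hy
  · rintro rfl; omega
  · rintro rfl; omega

/-- `l + r` is `h` or `h + 1`, and the parity of `l - r` decides which. -/
theorem eq_of_h_eq {k : ℕ} {x y : hexVertices k} (h : x.1.2.1 = y.1.2.1)
    (h' : x.1.1 - x.1.2.2 = y.1.1 - y.1.2.2) : x = y := by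
  have hX := x.2
  have hY := y.2
  simp only [hexVertices, Set.mem_ofPred_eq] at *
  refine Subtype.ext (Prod.ext ?_ (Prod.ext ?_ ?_)) <;> omega

theorem hexVertices_finite (k : ℕ) : (hexVertices k).Finite := by
  refine (((Set.finite_Icc (-(k : ℤ) + 1) k).prod ((Set.finite_Icc (-(k : ℤ) + 1) k).prod
    (Set.finite_Icc (-(k : ℤ) + 1) k)))).subset ?_
  rintro ⟨l, h, r⟩ hp
  exact ⟨hp.2.1, hp.2.2.1, hp.2.2.2⟩

theorem IsMutualVisibilitySet.encard_le {k : ℕ} {Y : Set (hexVertices k)}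
    (hY : IsMutualVisibilitySet (hexGrid k) Y) : Y.encard ≤ ((4 * k : ℕ) : ℕ∞) := by
  classical
  have : Finite (hexVertices k) := hexVertices_finite k
  obtain ⟨S, rfl⟩ := Y.toFinite.exists_finset_coe
  rw [Set.encard_coe_eq_coe_finsetCard]
  norm_cast
  -- The fibres over the `2k` h-numbers have at most two elements: of three, the one with the middle
  -- value of `l - r` would block the other two.
  have key := Finset.card_le_mul_card_image_of_maps_to (s := S) (f := fun v => v.1.2.1)
    (t := Finset.Icc (-(k : ℤ) + 1) k) (fun v _ => Finset.mem_Icc.2 v.2.2.2.1) 2 ?_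
  · rw [Int.card_Icc] at key
    omega
  intro h _
  by_contra! hlt
  obtain ⟨x, hx, y, hy, z, hz, hxy, hxz, hyz⟩ := Finset.two_lt_card.1 hlt
  rw [Finset.mem_filter] at hx hy hz
  have blocked : ∀ u v w : hexVertices k, (u ∈ S ∧ u.1.2.1 = h) → (v ∈ S ∧ v.1.2.1 = h) →
      (w ∈ S ∧ w.1.2.1 = h) → u.1.1 - u.1.2.2 < v.1.1 - v.1.2.2 →
      v.1.1 - v.1.2.2 < w.1.1 - w.1.2.2 → False := by
    intro u v w hu hv hw h1 h2
    refine not_visible_of_h_eq (Y := (S : Set (hexVertices k))) hv.1 (hu.2.trans hv.2.symm)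
      (hv.2.trans hw.2.symm) h1 h2 (hY u hu.1 w hw.1 ?_)
    rintro rfl
    omega
  have n1 := fun e => hxy (eq_of_h_eq (hx.2.trans hy.2.symm) e)
  have n2 := fun e => hxz (eq_of_h_eq (hx.2.trans hz.2.symm) e)
  have n3 := fun e => hyz (eq_of_h_eq (hy.2.trans hz.2.symm) e)
  have b1 := blocked x y z hx hy hz
  have b2 := blocked x z y hx hz hy
  have b3 := blocked y x z hy hx hz
  have b4 := blocked y z x hy hz hx
  have b5 := blocked z x y hz hx hy
  have b6 := blocked z y x hz hy hx
  rcases lt_trichotomy (x.1.1 - x.1.2.2) (y.1.1 - y.1.2.2) with h1 | h1 | h1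
  · rcases lt_trichotomy (y.1.1 - y.1.2.2) (z.1.1 - z.1.2.2) with h2 | h2 | h2
    · exact b1 h1 h2
    · exact n3 h2
    · rcases lt_trichotomy (x.1.1 - x.1.2.2) (z.1.1 - z.1.2.2) with h3 | h3 | h3
      exacts [b2 h3 h2, n2 h3, b5 h3 h1]
  · exact n1 h1
  · rcases lt_trichotomy (x.1.1 - x.1.2.2) (z.1.1 - z.1.2.2) with h2 | h2 | h2
    · exact b3 h1 h2
    · exact n2 h2
    · rcases lt_trichotomy (y.1.1 - y.1.2.2) (z.1.1 - z.1.2.2) with h3 | h3 | h3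
      exacts [b4 h3 h2, n3 h3, b6 h3 h1]

/-! ### Visibility of the vertices of `X_k` -/

/-- `hexPoint l r s` lies in `A_k ∪ B_k`. -/
abbrev InAB (k : ℕ) (l r s : ℤ) : Prop :=
  (s = 0 ∧ r = l - k - 2 ∧ 3 ≤ l ∧ l ≤ k) ∨ (s = 1 ∧ r = l - k + 2 ∧ 0 ≤ l ∧ l ≤ (k : ℤ) - 3) ∨
  (l = 2 ∧ r = -(k : ℤ) + 1 ∧ s = 1) ∨ (l = k ∧ r = 1 ∧ s = 1) ∨
  (l = (k : ℤ) - 1 ∧ r = 0 ∧ s = 0) ∨ (l = (k : ℤ) - 2 ∧ r = -1 ∧ s = 0)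

/-- `hexPoint l r s` lies in `X_k`. -/
abbrev InX (k : ℕ) (l r s : ℤ) : Prop := InAB k l r s ∨ InAB k (1 - l) (1 - r) (1 - s)

/-- The property of being different from all points of `X_k` except for two given points. -/
def Clear (k : ℕ) (xl xr xs yl yr ys : ℤ) (z : ℤ × ℤ × ℤ) : Prop :=
  ∀ a b c, z = hexPoint a b c → InX k a b c →
    (a = xl ∧ b = xr ∧ c = xs) ∨ (a = yl ∧ b = yr ∧ c = ys)

/-- The points `(xl, xr, xs)` and `(yl, yr, ys)` are joined by a shortest path without inner
vertices in `X_k`. -/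
def Sees (k : ℕ) (xl xr xs yl yr ys : ℤ) : Prop :=
  Reaches k (Clear k xl xr xs yl yr ys) (hexPoint xl xr xs) (hexPoint yl yr ys)

/-- A box without points of `X_k` other than the two given ones. -/
theorem Reaches.clearBox {k : ℕ} {xl xr xs yl yr ys l r s l' r' s' : ℤ}
    (hu : InGrid k l r s ∧ InGrid k l' r' s')
    (hP : ∀ a b c, Between l a l' → Between r b r' →
      Between (l + r - s) (a + b - c) (l' + r' - s') → InX k a b c →
      (a = xl ∧ b = xr ∧ c = xs) ∨ (a = yl ∧ b = yr ∧ c = ys)) :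
    Reaches k (Clear k xl xr xs yl yr ys) (hexPoint l r s) (hexPoint l' r' s') := by
  refine .box hu.1 hu.2 fun a b c _ h1 h2 h3 a' b' c' e => ?_
  obtain ⟨rfl, rfl, rfl⟩ := hexPoint_inj.1 e
  exact hP a b c h1 h2 h3

/-- A strip of a box without points of `X_k` other than the two given ones. -/
theorem Reaches.clearStrip {k : ℕ} {xl xr xs yl yr ys l r s l' r' s' : ℤ} (t t' : ℤ)
    (hu : InGrid k l r s ∧ InGrid k l' r' s')
    (ht : t < t' ∧ l ≤ l' ∧ r ≤ r' ∧ l + r - s ≤ l' + r' - s' ∧ t ≤ l - r ∧ l - r ≤ t' ∧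
      t ≤ l' - r' ∧ l' - r' ≤ t')
    (hP : ∀ a b c, l ≤ a → a ≤ l' → r ≤ b → b ≤ r' → l + r - s ≤ a + b - c →
      a + b - c ≤ l' + r' - s' → t ≤ a - b → a - b ≤ t' → InX k a b c →
      (a = xl ∧ b = xr ∧ c = xs) ∨ (a = yl ∧ b = yr ∧ c = ys)) :
    Reaches k (Clear k xl xr xs yl yr ys) (hexPoint l r s) (hexPoint l' r' s') := by
  refine .strip t t' hu.1 hu.2 (by omega) (by omega)
    fun a b c _ h1 h2 h3 h4 h5 h6 h7 h8 a' b' c' e => ?_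
  obtain ⟨rfl, rfl, rfl⟩ := hexPoint_inj.1 e
  exact hP a b c h1 h2 h3 h4 h5 h6 h7 h8

/-- A box spanned in the direction of decreasing `l` and increasing `r`. -/
theorem Reaches.clearBoxL {k : ℕ} {xl xr xs yl yr ys l r s l' r' s' : ℤ}
    (hu : InGrid k l r s ∧ InGrid k l' r' s') (hlr : l' ≤ l ∧ r ≤ r')
    (hP : ∀ a b c, l' ≤ a → a ≤ l → r ≤ b → b ≤ r' →
      Between (l + r - s) (a + b - c) (l' + r' - s') → InX k a b c →
      (a = xl ∧ b = xr ∧ c = xs) ∨ (a = yl ∧ b = yr ∧ c = ys)) :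
    Reaches k (Clear k xl xr xs yl yr ys) (hexPoint l r s) (hexPoint l' r' s') :=
  .clearBox hu fun a b c h1 h2 => hP a b c (by omega) (by omega) (by omega) (by omega)

/-- A box spanned in the direction in which all three line numbers increase. -/
theorem Reaches.clearBoxUp {k : ℕ} {xl xr xs yl yr ys l r s l' r' s' : ℤ}
    (hu : InGrid k l r s ∧ InGrid k l' r' s')
    (hlr : l ≤ l' ∧ r ≤ r' ∧ l + r - s ≤ l' + r' - s')
    (hP : ∀ a b c, l ≤ a → a ≤ l' → r ≤ b → b ≤ r' → l + r - s ≤ a + b - c →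
      a + b - c ≤ l' + r' - s' → InX k a b c →
      (a = xl ∧ b = xr ∧ c = xs) ∨ (a = yl ∧ b = yr ∧ c = ys)) :
    Reaches k (Clear k xl xr xs yl yr ys) (hexPoint l r s) (hexPoint l' r' s') :=
  .clearBox hu fun a b c h1 h2 h3 =>
    hP a b c (by omega) (by omega) (by omega) (by omega) (by omega) (by omega)

theorem Sees.symm {k : ℕ} {xl xr xs yl yr ys : ℤ} (h : Sees k xl xr xs yl yr ys) :
    Sees k yl yr ys xl xr xs :=
  Reaches.symm (h.mono fun _ hz a b c e hX => (hz a b c e hX).symm)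

/-! #### Explicit shortest paths for the pairs of types of vertices

The vertices of `A_k ∪ B_k` are `a`, `A` (for the `a_i`), `B` (for the `b_i`), `b`, `b'`, `b''`. -/

/-- The only vertex of `X_k` with `k ≤ l - r ≤ k + 1` is `a`. In the lemmas below a strip may
include `l - r = k - 1` when `b`, `b'`, `b''` are endpoints or outside the box. -/
theorem sees_a_A {k : ℕ} (hk : 4 ≤ k) {m : ℤ} (hy : 3 ≤ m ∧ m ≤ k) :
    Sees k 2 (-(k : ℤ) + 1) 1 m (m - k - 2) 0 :=
  .trans (l' := m - 1) (r' := m - k - 2) (s' := 0)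
      (.clearStrip k ((k : ℤ) + 1) (by omega) (by omega) (by omega))
      (.clearBoxUp (by omega) (by omega) (by omega)) (by omega)

theorem sees_a_B {k : ℕ} (hk : 4 ≤ k) {m : ℤ} (hy : 0 ≤ m ∧ m ≤ (k : ℤ) - 3) :
    Sees k 2 (-(k : ℤ) + 1) 1 m (m - k + 2) 1 := by
  rcases le_or_gt m 2 with h | h
  · exact .clearBoxL (by omega) (by omega) (by omega)
  · exact .trans (l' := m) (r' := m - k + 1) (s' := 1)
      (.clearStrip ((k : ℤ) - 1) ((k : ℤ) + 1) (by omega) (by omega) (by omega))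
      (.clearBoxUp (by omega) (by omega) (by omega)) (by omega)

theorem sees_a_b {k : ℕ} (hk : 4 ≤ k) :
    Sees k 2 (-(k : ℤ) + 1) 1 ((k : ℤ)) 1 1 :=
  .trans (l' := k) (r' := 0) (s' := 0)
      (.clearStrip k ((k : ℤ) + 1) (by omega) (by omega) (by omega))
      (.clearBoxUp (by omega) (by omega) (by omega)) (by omega)

theorem sees_a_b' {k : ℕ} (hk : 4 ≤ k) :
    Sees k 2 (-(k : ℤ) + 1) 1 ((k : ℤ) - 1) 0 0 :=
  .trans (l' := k - 1) (r' := -1) (s' := 1)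
      (.clearStrip k ((k : ℤ) + 1) (by omega) (by omega) (by omega))
      (.clearBoxUp (by omega) (by omega) (by omega)) (by omega)

theorem sees_a_b'' {k : ℕ} (hk : 4 ≤ k) :
    Sees k 2 (-(k : ℤ) + 1) 1 ((k : ℤ) - 2) (-1) 0 :=
  .clearStrip ((k : ℤ) - 1) ((k : ℤ) + 1) (by omega) (by omega) (by omega)

/-- The path follows an r-line and then an l-line, on the outer side of the column. -/
theorem sees_A_A {k : ℕ} (hk : 4 ≤ k) {l m : ℤ} (hx : 3 ≤ l ∧ l ≤ k) (hy : 3 ≤ m ∧ m ≤ k) (h : l < m) :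
    Sees k l (l - k - 2) 0 m (m - k - 2) 0 :=
  .trans (l' := m) (r' := l - k - 2) (s' := 0)
      (.clearBoxUp (by omega) (by omega) (by omega))
      (.clearBoxUp (by omega) (by omega) (by omega)) (by omega)

theorem sees_A_B {k : ℕ} (hk : 4 ≤ k) {l m : ℤ} (hx : 3 ≤ l ∧ l ≤ k) (hy : 0 ≤ m ∧ m ≤ (k : ℤ) - 3) :
    Sees k l (l - k - 2) 0 m (m - k + 2) 1 := by
  rcases le_or_gt l m with h | h
  · exact .trans (l' := l) (r' := l - k - 1) (s' := 0)
      (.clearBoxUp (by omega) (by omega) (by omega))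
      (.trans (l' := m) (r' := m - k) (s' := 0)
      (.clearStrip k ((k : ℤ) + 1) (by omega) (by omega) (by omega))
      (.clearBoxUp (by omega) (by omega) (by omega)) (by omega)) (by omega)
  -- Beyond `m + 4` the r-number `l - k - 2` exceeds `m - k + 2`, so all three numbers grow from the
  -- `b_i` to the `a_i`. In between, `l` falls while `r` does not.
  rcases lt_or_ge (m + 4) l with h' | h'
  · apply Sees.symm
    exact .trans (l' := m + 1) (r' := m - k + 2) (s' := 0)
      (.clearBoxUp (by omega) (by omega) (by omega))
      (.trans (l' := l - 1) (r' := l - k - 2) (s' := 0)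
      (.clearStrip ((k : ℤ) - 1) ((k : ℤ) + 1) (by omega) (by omega) (by omega))
      (.clearBoxUp (by omega) (by omega) (by omega)) (by omega)) (by omega)
  -- In the two extreme cases the box contains `a`, respectively `b''`, which must be bypassed.
  by_cases h₁ : m = 0 ∧ l = 3
  · exact .trans (l' := l) (r' := m - k + 2) (s' := 1)
      (.clearBoxL (by omega) (by omega) (by omega))
      (.clearBoxL (by omega) (by omega) (by omega)) (by omega)
  by_cases h₂ : m = k - 3 ∧ l = k
  · exact .trans (l' := k - 1) (r' := -2) (s' := 1)
      (.clearBoxL (by omega) (by omega) (by omega))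
      (.clearBoxL (by omega) (by omega) (by omega)) (by omega)
  exact .clearBoxL (by omega) (by omega) (by omega)

theorem sees_A_b {k : ℕ} (hk : 4 ≤ k) {l : ℤ} (hx : 3 ≤ l ∧ l ≤ k) :
    Sees k l (l - k - 2) 0 ((k : ℤ)) 1 1 :=
  .trans (l' := l) (r' := l - k - 1) (s' := 1)
      (.clearBoxUp (by omega) (by omega) (by omega))
      (.trans (l' := k) (r' := -1) (s' := 1)
      (.clearStrip k ((k : ℤ) + 1) (by omega) (by omega) (by omega))
      (.clearBoxUp (by omega) (by omega) (by omega)) (by omega)) (by omega)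

theorem sees_A_b' {k : ℕ} (hk : 4 ≤ k) {l : ℤ} (hx : 3 ≤ l ∧ l ≤ k) :
    Sees k l (l - k - 2) 0 ((k : ℤ) - 1) 0 0 := by
  rcases eq_or_lt_of_le hx.2 with h | h
  · exact .clearBoxL (by omega) (by omega) (by omega)
  · exact .trans (l' := l) (r' := l - k - 1) (s' := 1)
      (.clearBoxUp (by omega) (by omega) (by omega))
      (.trans (l' := k - 1) (r' := -2) (s' := 1)
      (.clearStrip k ((k : ℤ) + 1) (by omega) (by omega) (by omega))
      (.clearBoxUp (by omega) (by omega) (by omega)) (by omega)) (by omega)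

theorem sees_A_b'' {k : ℕ} (hk : 4 ≤ k) {l : ℤ} (hx : 3 ≤ l ∧ l ≤ k) :
    Sees k l (l - k - 2) 0 ((k : ℤ) - 2) (-1) 0 := by
  rcases lt_or_ge ((k : ℤ) - 2) l with h | h
  · exact .clearBoxL (by omega) (by omega) (by omega)
  · exact .trans (l' := l) (r' := l - k - 1) (s' := 1)
      (.clearBoxUp (by omega) (by omega) (by omega))
      (.clearStrip ((k : ℤ) - 1) ((k : ℤ) + 1) (by omega) (by omega) (by omega)) (by omega)

/-- Here the path bends through the inner side of the column, where `l - r < k - 2`. -/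
theorem sees_B_B {k : ℕ} (hk : 4 ≤ k) {l m : ℤ} (hx : 0 ≤ l ∧ l ≤ (k : ℤ) - 3) (hy : 0 ≤ m ∧ m ≤ (k : ℤ) - 3) (h : l < m) :
    Sees k l (l - k + 2) 1 m (m - k + 2) 1 :=
  .trans (l' := l) (r' := m - k + 2) (s' := 0)
      (.clearBoxUp (by omega) (by omega) (by omega))
      (.clearBoxUp (by omega) (by omega) (by omega)) (by omega)

theorem sees_B_b {k : ℕ} (hk : 4 ≤ k) {l : ℤ} (hx : 0 ≤ l ∧ l ≤ (k : ℤ) - 3) :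
    Sees k l (l - k + 2) 1 ((k : ℤ)) 1 1 :=
  .trans (l' := l) (r' := 1) (s' := 1)
      (.clearBoxUp (by omega) (by omega) (by omega))
      (.clearBoxUp (by omega) (by omega) (by omega)) (by omega)

theorem sees_B_b' {k : ℕ} (hk : 4 ≤ k) {l : ℤ} (hx : 0 ≤ l ∧ l ≤ (k : ℤ) - 3) :
    Sees k l (l - k + 2) 1 ((k : ℤ) - 1) 0 0 :=
  .trans (l' := l) (r' := 0) (s' := 0)
      (.clearBoxUp (by omega) (by omega) (by omega))
      (.clearBoxUp (by omega) (by omega) (by omega)) (by omega)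

theorem sees_B_b'' {k : ℕ} (hk : 4 ≤ k) {l : ℤ} (hx : 0 ≤ l ∧ l ≤ (k : ℤ) - 3) :
    Sees k l (l - k + 2) 1 ((k : ℤ) - 2) (-1) 0 :=
  .trans (l' := l + 1) (r' := l - k + 2) (s' := 1)
      (.clearBoxUp (by omega) (by omega) (by omega))
      (.clearStrip ((k : ℤ) - 1) ((k : ℤ)) (by omega) (by omega) (by omega)) (by omega)

theorem sees_b_b' {k : ℕ} (hk : 4 ≤ k) :
    Sees k ((k : ℤ)) 1 1 ((k : ℤ) - 1) 0 0 := by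
  apply Sees.symm
  exact .clearBoxUp (by omega) (by omega) (by omega)

theorem sees_b_b'' {k : ℕ} (hk : 4 ≤ k) :
    Sees k ((k : ℤ)) 1 1 ((k : ℤ) - 2) (-1) 0 := by
  apply Sees.symm
  exact .trans (l' := k) (r' := -1) (s' := 0)
      (.clearBoxUp (by omega) (by omega) (by omega))
      (.clearBoxUp (by omega) (by omega) (by omega)) (by omega)

theorem sees_b'_b'' {k : ℕ} (hk : 4 ≤ k) :
    Sees k ((k : ℤ) - 1) 0 0 ((k : ℤ) - 2) (-1) 0 := by
  apply Sees.symm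
  exact .clearBoxUp (by omega) (by omega) (by omega)

/-! ### Pairs across the middle region -/

theorem sees_a_rot_a {k : ℕ} (hk : 4 ≤ k) :
    Sees k 2 (-(k : ℤ) + 1) 1 (1 - 2) (1 - (-k + 1)) (1 - 1) :=
  -- Keeping `l = 2` up to `h = 4 - k` passes `b_1`, which lies on `h = 3 - k`. The last two
  -- waypoints are the rotated first two, in reverse order.
  .trans (l' := 2) (r' := 3 - k) (s' := 1)
      (.clearBoxL (by omega) (by omega) (by omega))
      (.trans (l' := 1) (r' := 4 - k) (s' := 1)
      (.clearBoxL (by omega) (by omega) (by omega))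
      (.trans (l' := 0) (r' := k - 3) (s' := 0)
      (.clearBoxL (by omega) (by omega) (by omega))
      (.trans (l' := -1) (r' := k - 2) (s' := 0)
      (.clearBoxL (by omega) (by omega) (by omega))
      (.clearBoxL (by omega) (by omega) (by omega)) (by omega)) (by omega)) (by omega)) (by omega)

theorem sees_a_rot_A {k : ℕ} (hk : 4 ≤ k) {m : ℤ} (hy : 3 ≤ m ∧ m ≤ k) :
    Sees k 2 (-(k : ℤ) + 1) 1 (1 - m) (1 - (m - k - 2)) (1 - 0) :=
  .trans (l' := 0) (r' := 3 - k) (s' := 1)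
      (.clearBoxL (by omega) (by omega) (by omega))
      (.trans (l' := 3 - m) (r' := k + 1 - m) (s' := 1)
      (.clearBoxL (by omega) (by omega) (by omega))
      (.clearBoxL (by omega) (by omega) (by omega)) (by omega)) (by omega)

theorem sees_a_rot_B {k : ℕ} (hk : 4 ≤ k) {m : ℤ} (hy : 0 ≤ m ∧ m ≤ (k : ℤ) - 3) :
    Sees k 2 (-(k : ℤ) + 1) 1 (1 - m) (1 - (m - k + 2)) (1 - 1) := by
  rcases eq_or_lt_of_le hy.1 with h | h
  · exact .trans (l' := 2) (r' := 2 - k) (s' := 0)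
      (.clearBoxL (by omega) (by omega) (by omega))
      (.trans (l' := 1) (r' := 3 - k) (s' := 0)
      (.clearBoxL (by omega) (by omega) (by omega))
      (.clearBoxL (by omega) (by omega) (by omega)) (by omega)) (by omega)
  · exact .trans (l' := 0) (r' := 2 - k) (s' := 0)
      (.clearBoxL (by omega) (by omega) (by omega))
      (.clearBoxL (by omega) (by omega) (by omega)) (by omega)

theorem sees_a_rot_b {k : ℕ} (hk : 4 ≤ k) :
    Sees k 2 (-(k : ℤ) + 1) 1 (1 - k) (1 - 1) (1 - 1) :=
  .trans (l' := 2 - k) (r' := 0) (s' := 0)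
      (.clearBoxL (by omega) (by omega) (by omega))
      (.clearBoxL (by omega) (by omega) (by omega)) (by omega)

theorem sees_a_rot_b' {k : ℕ} (hk : 4 ≤ k) :
    Sees k 2 (-(k : ℤ) + 1) 1 (1 - (k - 1)) (1 - 0) (1 - 0) :=
  .clearBoxL (by omega) (by omega) (by omega)

theorem sees_a_rot_b'' {k : ℕ} (hk : 4 ≤ k) :
    Sees k 2 (-(k : ℤ) + 1) 1 (1 - (k - 2)) (1 - (-1)) (1 - 0) :=
  .trans (l' := 3 - k) (r' := 0) (s' := 1)
      (.clearBoxL (by omega) (by omega) (by omega))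
      (.clearBoxL (by omega) (by omega) (by omega)) (by omega)

/-- The h-line through an `a_i` meets no other vertex of `A_k ∪ B_k`, so it leads freely through a
gap in the column of the `b_i` to `(l - 2, l - k + 1, 1)`, where `l - r = k - 3`. -/
theorem sees_A_rot_A {k : ℕ} (hk : 4 ≤ k) {l m : ℤ} (hx : 3 ≤ l ∧ l ≤ k) (hy : 3 ≤ m ∧ m ≤ k) :
    Sees k l (l - k - 2) 0 (1 - m) (1 - (m - k - 2)) (1 - 0) := by
  -- This means `l = m = k`, the only case in which `r` would fall between the generic waypoints.
  by_cases h : l + m = 2 * k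
  · exact .trans (l' := l - 2) (r' := l - k) (s' := 0)
      (.clearBoxL (by omega) (by omega) (by omega))
      (.trans (l' := 3 - m) (r' := 1) (s' := 1)
      (.clearBoxL (by omega) (by omega) (by omega))
      (.clearBoxL (by omega) (by omega) (by omega)) (by omega)) (by omega)
  · exact .trans (l' := l - 2) (r' := l - k + 1) (s' := 1)
      (.clearBoxL (by omega) (by omega) (by omega))
      (.trans (l' := 3 - m) (r' := k - m) (s' := 0)
      (.clearBoxL (by omega) (by omega) (by omega))
      (.clearBoxL (by omega) (by omega) (by omega)) (by omega)) (by omega)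

theorem sees_A_rot_B {k : ℕ} (hk : 4 ≤ k) {l m : ℤ} (hx : 3 ≤ l ∧ l ≤ k) (hy : 0 ≤ m ∧ m ≤ (k : ℤ) - 3) :
    Sees k l (l - k - 2) 0 (1 - m) (1 - (m - k + 2)) (1 - 1) :=
  .trans (l' := l - 2) (r' := l - k + 1) (s' := 1)
      (.clearBoxL (by omega) (by omega) (by omega))
      (.clearBoxL (by omega) (by omega) (by omega)) (by omega)

theorem sees_A_rot_b {k : ℕ} (hk : 4 ≤ k) {l : ℤ} (hx : 3 ≤ l ∧ l ≤ k) :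
    Sees k l (l - k - 2) 0 (1 - k) (1 - 1) (1 - 1) := by
  rcases eq_or_lt_of_le hx.2 with h | h
  · exact .trans (l' := k - 1) (r' := 0) (s' := 1)
      (.clearBoxL (by omega) (by omega) (by omega))
      (.clearBoxL (by omega) (by omega) (by omega)) (by omega)
  · exact .trans (l' := l - 2) (r' := l - k + 1) (s' := 1)
      (.clearBoxL (by omega) (by omega) (by omega))
      (.clearBoxL (by omega) (by omega) (by omega)) (by omega)

theorem sees_A_rot_b' {k : ℕ} (hk : 4 ≤ k) {l : ℤ} (hx : 3 ≤ l ∧ l ≤ k) :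
    Sees k l (l - k - 2) 0 (1 - (k - 1)) (1 - 0) (1 - 0) :=
  .trans (l' := l - 2) (r' := l - k + 1) (s' := 1)
      (.clearBoxL (by omega) (by omega) (by omega))
      (.clearBoxL (by omega) (by omega) (by omega)) (by omega)

theorem sees_A_rot_b'' {k : ℕ} (hk : 4 ≤ k) {l : ℤ} (hx : 3 ≤ l ∧ l ≤ k) :
    Sees k l (l - k - 2) 0 (1 - (k - 2)) (1 - (-1)) (1 - 0) :=
  .trans (l' := l - 2) (r' := l - k + 1) (s' := 1)
      (.clearBoxL (by omega) (by omega) (by omega))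
      (.trans (l' := 3 - k) (r' := 1) (s' := 0)
      (.clearBoxL (by omega) (by omega) (by omega))
      (.clearBoxL (by omega) (by omega) (by omega)) (by omega)) (by omega)

theorem sees_B_rot_B {k : ℕ} (hk : 4 ≤ k) {l m : ℤ} (hx : 0 ≤ l ∧ l ≤ (k : ℤ) - 3) (hy : 0 ≤ m ∧ m ≤ (k : ℤ) - 3) :
    Sees k l (l - k + 2) 1 (1 - m) (1 - (m - k + 2)) (1 - 1) := by
  -- Only for this pair does `l` increase, from 0 to 1.
  by_cases h : l = 0 ∧ m = 0
  · exact .trans (l' := 0) (r' := 0) (s' := 0)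
      (.clearBoxUp (by omega) (by omega) (by omega))
      (.trans (l' := 1) (r' := 0) (s' := 1)
      (.clearBoxUp (by omega) (by omega) (by omega))
      (.clearBoxUp (by omega) (by omega) (by omega)) (by omega)) (by omega)
  · exact .clearBoxL (by omega) (by omega) (by omega)

theorem sees_B_rot_b {k : ℕ} (hk : 4 ≤ k) {l : ℤ} (hx : 0 ≤ l ∧ l ≤ (k : ℤ) - 3) :
    Sees k l (l - k + 2) 1 (1 - k) (1 - 1) (1 - 1) :=
  .clearBoxL (by omega) (by omega) (by omega)

theorem sees_B_rot_b' {k : ℕ} (hk : 4 ≤ k) {l : ℤ} (hx : 0 ≤ l ∧ l ≤ (k : ℤ) - 3) :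
    Sees k l (l - k + 2) 1 (1 - (k - 1)) (1 - 0) (1 - 0) :=
  .clearBoxL (by omega) (by omega) (by omega)

theorem sees_B_rot_b'' {k : ℕ} (hk : 4 ≤ k) {l : ℤ} (hx : 0 ≤ l ∧ l ≤ (k : ℤ) - 3) :
    Sees k l (l - k + 2) 1 (1 - (k - 2)) (1 - (-1)) (1 - 0) :=
  .trans (l' := 3 - k) (r' := 1) (s' := 0)
      (.clearBoxL (by omega) (by omega) (by omega))
      (.clearBoxL (by omega) (by omega) (by omega)) (by omega)

theorem sees_b_rot_b {k : ℕ} (hk : 4 ≤ k) :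
    Sees k ((k : ℤ)) 1 1 (1 - k) (1 - 1) (1 - 1) :=
  -- The box contains `b'` on `r = 0` and its rotated image on `r = 1`; the path keeps to `r = 1`
  -- past the former and changes to `r = 0` before the latter.
  .trans (l' := 2) (r' := 1) (s' := 0)
      (.clearBox (by omega) (by omega))
      (.trans (l' := -1) (r' := 0) (s' := 0)
      (.clearBox (by omega) (by omega))
      (.clearBox (by omega) (by omega)) (by omega)) (by omega)

theorem sees_b_rot_b' {k : ℕ} (hk : 4 ≤ k) :
    Sees k ((k : ℤ)) 1 1 (1 - (k - 1)) (1 - 0) (1 - 0) :=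
  .clearBoxL (by omega) (by omega) (by omega)

theorem sees_b_rot_b'' {k : ℕ} (hk : 4 ≤ k) :
    Sees k ((k : ℤ)) 1 1 (1 - (k - 2)) (1 - (-1)) (1 - 0) :=
  .trans (l' := 3 - k) (r' := 1) (s' := 0)
      (.clearBoxL (by omega) (by omega) (by omega))
      (.clearBoxL (by omega) (by omega) (by omega)) (by omega)

theorem sees_b'_rot_b' {k : ℕ} (hk : 4 ≤ k) :
    Sees k ((k : ℤ) - 1) 0 0 (1 - (k - 1)) (1 - 0) (1 - 0) :=
  .clearBoxL (by omega) (by omega) (by omega)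

theorem sees_b'_rot_b'' {k : ℕ} (hk : 4 ≤ k) :
    Sees k ((k : ℤ) - 1) 0 0 (1 - (k - 2)) (1 - (-1)) (1 - 0) :=
  .trans (l' := 3 - k) (r' := 1) (s' := 0)
      (.clearBoxL (by omega) (by omega) (by omega))
      (.clearBoxL (by omega) (by omega) (by omega)) (by omega)

theorem sees_b''_rot_b'' {k : ℕ} (hk : 4 ≤ k) :
    Sees k ((k : ℤ) - 2) (-1) 0 (1 - (k - 2)) (1 - (-1)) (1 - 0) :=
  .trans (l' := k - 4) (r' := 1) (s' := 0)
      (.clearBoxL (by omega) (by omega) (by omega))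
      (.trans (l' := 3 - k) (r' := 1) (s' := 0)
      (.clearBoxL (by omega) (by omega) (by omega))
      (.clearBoxL (by omega) (by omega) (by omega)) (by omega)) (by omega)

/-- Two distinct vertices of `A_k ∪ B_k` see each other. -/
theorem sees_of_inAB {k : ℕ} (hk : 4 ≤ k) {l r s l' r' s' : ℤ} (hx : InAB k l r s)
    (hy : InAB k l' r' s') (hne : ¬ (l = l' ∧ r = r' ∧ s = s')) : Sees k l r s l' r' s' := by
  rcases hx with ⟨rfl, rfl, hx⟩ | ⟨rfl, rfl, hx⟩ | ⟨rfl, rfl, rfl⟩ | ⟨rfl, rfl, rfl⟩ |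
    ⟨rfl, rfl, rfl⟩ | ⟨rfl, rfl, rfl⟩ <;>
  rcases hy with ⟨rfl, rfl, hy⟩ | ⟨rfl, rfl, hy⟩ | ⟨rfl, rfl, rfl⟩ | ⟨rfl, rfl, rfl⟩ |
    ⟨rfl, rfl, rfl⟩ | ⟨rfl, rfl, rfl⟩
  · rcases lt_trichotomy l l' with h | rfl | h
    exacts [sees_A_A hk hx hy h, absurd ⟨rfl, rfl, rfl⟩ hne, (sees_A_A hk hy hx h).symm]
  · exact sees_A_B hk hx hy
  · exact (sees_a_A hk hx).symm
  · exact sees_A_b hk hx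
  · exact sees_A_b' hk hx
  · exact sees_A_b'' hk hx
  · exact (sees_A_B hk hy hx).symm
  · rcases lt_trichotomy l l' with h | rfl | h
    exacts [sees_B_B hk hx hy h, absurd ⟨rfl, rfl, rfl⟩ hne, (sees_B_B hk hy hx h).symm]
  · exact (sees_a_B hk hx).symm
  · exact sees_B_b hk hx
  · exact sees_B_b' hk hx
  · exact sees_B_b'' hk hx
  · exact sees_a_A hk hy
  · exact sees_a_B hk hy
  · exact absurd ⟨rfl, rfl, rfl⟩ hne
  · exact sees_a_b hk
  · exact sees_a_b' hk
  · exact sees_a_b'' hk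
  · exact (sees_A_b hk hy).symm
  · exact (sees_B_b hk hy).symm
  · exact (sees_a_b hk).symm
  · exact absurd ⟨rfl, rfl, rfl⟩ hne
  · exact sees_b_b' hk
  · exact sees_b_b'' hk
  · exact (sees_A_b' hk hy).symm
  · exact (sees_B_b' hk hy).symm
  · exact (sees_a_b' hk).symm
  · exact (sees_b_b' hk).symm
  · exact absurd ⟨rfl, rfl, rfl⟩ hne
  · exact sees_b'_b'' hk
  · exact (sees_A_b'' hk hy).symm
  · exact (sees_B_b'' hk hy).symm
  · exact (sees_a_b'' hk).symm
  · exact (sees_b_b'' hk).symm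
  · exact (sees_b'_b'' hk).symm
  · exact absurd ⟨rfl, rfl, rfl⟩ hne

/-! ### Symmetry under the rotation -/

theorem rot180_hexPoint (l r s : ℤ) :
    rot180 (hexPoint l r s) = hexPoint (1 - l) (1 - r) (1 - s) := by
  simp only [rot180, hexPoint, Prod.mk.injEq, true_and, and_true]
  ring

theorem rot180_rot180 (p : ℤ × ℤ × ℤ) : rot180 (rot180 p) = p := by simp [rot180]

theorem rot180_mem {k : ℕ} {p : ℤ × ℤ × ℤ} (hp : p ∈ hexVertices k) :
    rot180 p ∈ hexVertices k := by
  obtain ⟨l, r, s, rfl, h⟩ := exists_hexPoint hp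
  rw [rot180_hexPoint, hexPoint_mem]
  omega

theorem taxicab_rot180 (p q : ℤ × ℤ × ℤ) : taxicab (rot180 p) (rot180 q) = taxicab p q := by
  simp only [taxicab, rot180, sub_sub_sub_cancel_left]
  rw [abs_sub_comm q.1, abs_sub_comm q.2.1, abs_sub_comm q.2.2]

/-- The rotation by 180 degrees as an endomorphism of the grid. -/
def hexGridRot (k : ℕ) : hexGrid k →g hexGrid k where
  toFun v := ⟨rot180 v, rot180_mem v.2⟩
  map_rel' {u v} h := hexGrid_adj.2 ((taxicab_rot180 u v).trans (hexGrid_adj.1 h))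

theorem Reaches.rot180 {k : ℕ} {P Q : ℤ × ℤ × ℤ → Prop} (hPQ : ∀ z, P z → Q (rot180 z))
    {u v : ℤ × ℤ × ℤ} (h : Reaches k P u v) : Reaches k Q (_root_.rot180 u) (_root_.rot180 v) := by
  obtain ⟨hu, hv, p, hp, hP⟩ := h
  obtain ⟨q, hq, hQ⟩ : ∃ q : (hexGrid k).Walk (hexGridRot k ⟨u, hu⟩) (hexGridRot k ⟨v, hv⟩),
      q.length = p.length ∧ ∀ z ∈ q.support, Q z := by
    refine ⟨p.map (hexGridRot k), p.length_map _, fun z hz => ?_⟩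
    rw [SimpleGraph.Walk.support_map, List.mem_map] at hz
    obtain ⟨w, hw, rfl⟩ := hz
    exact hPQ _ (hP w hw)
  exact ⟨rot180_mem hu, rot180_mem hv, q, by rw [taxicab_rot180, ← hp]; exact congrArg _ hq, hQ⟩

/-- The rotation preserves both the grid and `X_k`. -/
theorem Sees.rot180 {k : ℕ} {l r s l' r' s' : ℤ} (h : Sees k l r s l' r' s') :
    Sees k (1 - l) (1 - r) (1 - s) (1 - l') (1 - r') (1 - s') := by
  unfold Sees
  rw [← rot180_hexPoint, ← rot180_hexPoint]
  refine Reaches.rot180 (fun z hz a b c e hX => ?_) h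
  have := hz (1 - a) (1 - b) (1 - c) (by rw [← rot180_hexPoint, ← e, rot180_rot180])
    (hX.symm.imp id fun h => by simpa using h)
  omega

/-- A vertex of `A_k ∪ B_k` and one of the rotated set see each other. -/
theorem sees_rot_of_inAB {k : ℕ} (hk : 4 ≤ k) {l r s l' r' s' : ℤ} (hx : InAB k l r s)
    (hy : InAB k l' r' s') : Sees k l r s (1 - l') (1 - r') (1 - s') := by
  -- Rotating a path and reversing it exchanges the roles of the two types, so unordered pairs of
  -- types suffice.
  have turn : ∀ {l r s l' r' s' : ℤ}, Sees k l r s (1 - l') (1 - r') (1 - s') →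
      Sees k l' r' s' (1 - l) (1 - r) (1 - s) := fun h => by simpa using h.rot180.symm
  rcases hx with ⟨rfl, rfl, hx⟩ | ⟨rfl, rfl, hx⟩ | ⟨rfl, rfl, rfl⟩ | ⟨rfl, rfl, rfl⟩ |
    ⟨rfl, rfl, rfl⟩ | ⟨rfl, rfl, rfl⟩ <;>
  rcases hy with ⟨rfl, rfl, hy⟩ | ⟨rfl, rfl, hy⟩ | ⟨rfl, rfl, rfl⟩ | ⟨rfl, rfl, rfl⟩ |
    ⟨rfl, rfl, rfl⟩ | ⟨rfl, rfl, rfl⟩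
  · exact sees_A_rot_A hk hx hy
  · exact sees_A_rot_B hk hx hy
  · exact turn (sees_a_rot_A hk hx)
  · exact sees_A_rot_b hk hx
  · exact sees_A_rot_b' hk hx
  · exact sees_A_rot_b'' hk hx
  · exact turn (sees_A_rot_B hk hy hx)
  · exact sees_B_rot_B hk hx hy
  · exact turn (sees_a_rot_B hk hx)
  · exact sees_B_rot_b hk hx
  · exact sees_B_rot_b' hk hx
  · exact sees_B_rot_b'' hk hx
  · exact sees_a_rot_A hk hy
  · exact sees_a_rot_B hk hy
  · exact sees_a_rot_a hk
  · exact sees_a_rot_b hk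
  · exact sees_a_rot_b' hk
  · exact sees_a_rot_b'' hk
  · exact turn (sees_A_rot_b hk hy)
  · exact turn (sees_B_rot_b hk hy)
  · exact turn (sees_a_rot_b hk)
  · exact sees_b_rot_b hk
  · exact sees_b_rot_b' hk
  · exact sees_b_rot_b'' hk
  · exact turn (sees_A_rot_b' hk hy)
  · exact turn (sees_B_rot_b' hk hy)
  · exact turn (sees_a_rot_b' hk)
  · exact turn (sees_b_rot_b' hk)
  · exact sees_b'_rot_b' hk
  · exact sees_b'_rot_b'' hk
  · exact turn (sees_A_rot_b'' hk hy)
  · exact turn (sees_B_rot_b'' hk hy)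
  · exact turn (sees_a_rot_b'' hk)
  · exact turn (sees_b_rot_b'' hk)
  · exact turn (sees_b'_rot_b'' hk)
  · exact sees_b''_rot_b'' hk

theorem sees_of_inX {k : ℕ} (hk : 4 ≤ k) {l r s l' r' s' : ℤ} (hx : InX k l r s)
    (hy : InX k l' r' s') (hne : ¬ (l = l' ∧ r = r' ∧ s = s')) : Sees k l r s l' r' s' := by
  rcases hx with hx | hx <;> rcases hy with hy | hy
  · exact sees_of_inAB hk hx hy hne
  · simpa using sees_rot_of_inAB hk hx hy
  · simpa using (sees_rot_of_inAB hk hy hx).symm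
  · simpa using (sees_of_inAB hk hx hy (by omega)).rot180

/-! ### Membership in `X_k` and its cardinality -/

theorem mem_setAB {k : ℕ} (hk : 4 ≤ k) {l r s : ℤ} :
    hexPoint l r s ∈ setA k ∪ setB k ↔ InAB k l r s := by
  simp only [setA, setB, hexPoint, Finset.mem_union, Finset.mem_image, Finset.mem_range,
    Finset.mem_insert, Finset.mem_singleton, Prod.mk.injEq]
  constructor
  · rintro ((h | ⟨i, hi, h⟩) | ((h | h | h) | ⟨i, hi, h⟩)) <;> omega
  · rintro (h | h | h | h | h | h)
    · exact Or.inl (Or.inr ⟨(l - 3).toNat, by omega, by omega, by omega, by omega⟩)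
    · exact Or.inr (Or.inr ⟨l.toNat, by omega, by omega, by omega, by omega⟩)
    · exact Or.inl (Or.inl (by omega))
    · exact Or.inr (Or.inl (Or.inl (by omega)))
    · exact Or.inr (Or.inl (Or.inr (Or.inl (by omega))))
    · exact Or.inr (Or.inl (Or.inr (Or.inr (by omega))))

theorem rot180_injective : Function.Injective rot180 :=
  Function.Involutive.injective rot180_rot180

theorem setX_eq (k : ℕ) : setX k = (setA k ∪ setB k) ∪ (setA k ∪ setB k).image rot180 := by
  rw [setX, Finset.image_union, Finset.union_assoc (setA k ∪ setB k)]

theorem mem_image_rot180 {S : Finset (ℤ × ℤ × ℤ)} {p : ℤ × ℤ × ℤ} :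
    p ∈ S.image rot180 ↔ rot180 p ∈ S := by
  rw [← rot180_injective.mem_finset_image (s := S), rot180_rot180]

theorem mem_setX {k : ℕ} (hk : 4 ≤ k) {l r s : ℤ} : hexPoint l r s ∈ setX k ↔ InX k l r s := by
  rw [setX_eq, Finset.mem_union, mem_image_rot180, rot180_hexPoint, mem_setAB hk, mem_setAB hk]

theorem exists_hexPoint_eq (p : ℤ × ℤ × ℤ) : ∃ l r s, p = hexPoint l r s :=
  ⟨p.1, p.2.2, p.1 + p.2.2 - p.2.1, by simp [hexPoint]⟩

theorem setX_subset {k : ℕ} (hk : 4 ≤ k) : (setX k : Set (ℤ × ℤ × ℤ)) ⊆ hexVertices k := by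
  intro p hp
  obtain ⟨l, r, s, rfl⟩ := exists_hexPoint_eq p
  have h := (mem_setX hk).1 (Finset.mem_coe.1 hp)
  rw [hexPoint_mem]
  rcases h with (h | h | h | h | h | h) | (h | h | h | h | h | h) <;> omega

theorem card_setA {k : ℕ} (hk : 4 ≤ k) : (setA k).card = k - 1 := by
  rw [setA, Finset.card_union_of_disjoint, Finset.card_singleton, Finset.card_image_of_injective,
    Finset.card_range]
  · omega
  · intro i j h
    simp only [Prod.mk.injEq] at h
    omega
  · rw [Finset.disjoint_singleton_left]
    simp only [Finset.mem_image, Finset.mem_range, Prod.mk.injEq]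
    rintro ⟨i, -, h⟩
    omega

theorem card_setB {k : ℕ} (hk : 4 ≤ k) : (setB k).card = k + 1 := by
  rw [setB, Finset.card_union_of_disjoint, Finset.card_insert_of_notMem,
    Finset.card_insert_of_notMem, Finset.card_singleton, Finset.card_image_of_injective,
    Finset.card_range]
  · omega
  · intro i j h
    simp only [Prod.mk.injEq] at h
    omega
  · simp only [Finset.mem_singleton, Prod.mk.injEq]
    omega
  · simp only [Finset.mem_insert, Finset.mem_singleton, Prod.mk.injEq]
    omega
  · rw [Finset.disjoint_right]
    simp only [Finset.mem_image, Finset.mem_range, Finset.mem_insert, Finset.mem_singleton]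
    rintro _ ⟨i, hi, rfl⟩
    simp only [Prod.mk.injEq]
    omega

theorem card_setX {k : ℕ} (hk : 4 ≤ k) : (setX k).card = 4 * k := by
  have hAB : Disjoint (setA k) (setB k) := by
    simp only [Finset.disjoint_left, setA, setB, Finset.mem_union, Finset.mem_image,
      Finset.mem_range, Finset.mem_insert, Finset.mem_singleton]
    rintro _ (rfl | ⟨i, hi, rfl⟩) ((h | h | h) | ⟨j, hj, h⟩) <;>
      simp only [Prod.mk.injEq] at h <;> omega
  have hrot : Disjoint (setA k ∪ setB k) ((setA k ∪ setB k).image rot180) := by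
    rw [Finset.disjoint_left]
    intro p hp hp'
    obtain ⟨l, r, s, rfl⟩ := exists_hexPoint_eq p
    rw [mem_image_rot180, rot180_hexPoint, mem_setAB hk] at hp'
    rw [mem_setAB hk] at hp
    -- On `A_k ∪ B_k` the difference `l - r` is at least `k - 2 > 0`, and the rotation negates it.
    rcases hp with h | h | h | h | h | h <;> omega
  rw [setX_eq, Finset.card_union_of_disjoint hrot, Finset.card_image_of_injective _ rot180_injective,
    Finset.card_union_of_disjoint hAB, card_setA hk, card_setB hk]
  omega

/-! ### `X_k` is a `μ`-set -/

theorem isMutualVisibilitySet_setX {k : ℕ} (hk : 4 ≤ k) :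
    IsMutualVisibilitySet (hexGrid k) {v : hexVertices k | (v : ℤ × ℤ × ℤ) ∈ setX k} := by
  rintro ⟨x, hx⟩ hxX ⟨y, hy⟩ hyX hne
  obtain ⟨l, r, s, rfl⟩ := exists_hexPoint_eq x
  obtain ⟨l', r', s', rfl⟩ := exists_hexPoint_eq y
  rw [ne_eq, Subtype.mk.injEq, hexPoint_inj] at hne
  obtain ⟨_, _, p, hp, hP⟩ := sees_of_inX hk ((mem_setX hk).1 hxX) ((mem_setX hk).1 hyX) hne
  have hd : p.length = (hexGrid k).dist ⟨_, hx⟩ ⟨_, hy⟩ := by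
    have := hexGrid_dist ⟨_, hx⟩ ⟨_, hy⟩
    simp only at this
    omega
  refine ⟨p, p.isPath_of_length_eq_dist hd, hd, ?_⟩
  rintro ⟨z, hz⟩ hzp hzx hzy hzX
  obtain ⟨a, b, c, rfl⟩ := exists_hexPoint_eq z
  rcases hP _ hzp a b c rfl ((mem_setX hk).1 hzX) with ⟨rfl, rfl, rfl⟩ | ⟨rfl, rfl, rfl⟩
  exacts [hzx rfl, hzy rfl]

theorem encard_setX {k : ℕ} (hk : 4 ≤ k) :
    {v : hexVertices k | (v : ℤ × ℤ × ℤ) ∈ setX k}.encard = ((4 * k : ℕ) : ℕ∞) := by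
  have h := Subtype.val_injective.encard_image {v : hexVertices k | (v : ℤ × ℤ × ℤ) ∈ setX k}
  have e : Subtype.val '' {v : hexVertices k | (v : ℤ × ℤ × ℤ) ∈ setX k} = (setX k : Set _) := by
    ext p
    exact ⟨by rintro ⟨v, hv, rfl⟩; exact hv, fun hp => ⟨⟨p, setX_subset hk hp⟩, hp, rfl⟩⟩
  rw [← h, e, Set.encard_coe_eq_coe_finsetCard, card_setX hk]

theorem theorem1 (k : ℕ) (hk : 4 ≤ k) :
    (setX k : Set (ℤ × ℤ × ℤ)) ⊆ hexVertices k ∧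
      (setX k).card = 4 * k ∧
      IsMuSet (hexGrid k) {v : hexVertices k | (v : ℤ × ℤ × ℤ) ∈ setX k} ∧
      mutualVisibilityNumber (hexGrid k) = ((4 * k : ℕ) : ℕ∞) := by
  refine ⟨setX_subset hk, card_setX hk, ⟨isMutualVisibilitySet_setX hk, fun Y hY => ?_⟩, ?_⟩
  · rw [encard_setX hk]
    exact hY.encard_le
  · refine le_antisymm (iSup_le fun Y => Y.2.encard_le) ?_
    rw [← encard_setX hk]
    exact le_iSup (fun X : {X : Set (hexVertices k) // IsMutualVisibilitySet (hexGrid k) X} =>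
      X.1.encard) ⟨_, isMutualVisibilitySet_setX hk⟩
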